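/- Let $p \equiv q \equiv 1 \bmod 8$ be distinct primes with $(p/q) = +1$. For $\ell \in \{p,q\}$ let $\mathcal O_\ell$ be the ring of integers of $\mathbb Q(\sqrt{\ell}\,)$, let $\varepsilon_\ell$ be a fundamental unit of $\mathbb Q(\sqrt{\ell}\,)$ and $h(\ell)$ its class number, and let $\lambda_\ell \in \mathcal O_\ell$ be a totally positive element such that $(\lambda_\ell) = \mathfrak l^{h(\ell)}$ for a prime ideal $\mathfrak l$ of $\mathcal O_\ell$ above $2$. For a prime ideal $\mathfrak a$ of odd norm $N\mathfrak a$ and $\alpha \notin \mathfrak a$ let $[\alpha/\mathfrak a] = \pm 1$ be the quadratic residue symbol, $[\alpha/\mathfrak a] \equiv \alpha^{(N\mathfrak a - 1)/2} \bmod \mathfrak a$. Let $\mathfrak q$ be a prime ideal of $\mathcal O_p$ above $q$ and $\mathfrak p$ a prime ideal of $\mathcal O_q$ above $p$, and put $(\varepsilon_p/q) = [\varepsilon_p/\mathfrak q]$, $(\varepsilon_q/p) = [\varepsilon_q/\mathfrak p]$, $(\lambda_p/q) = [\lambda_p/\mathfrak q]$, $(\lambda_q/p) = [\lambda_q/\mathfrak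 p]$. Assume that $(\varepsilon_p/q) = (\varepsilon_q/p) = +1$. Then, for all such choices, $$\Big(\frac{\lambda_p}{q}\Big) = \Big(\frac{\lambda_q}{p}\Big).$$ Moreover, for all $\pi_2, \rho_2 \in \mathbb Z[\sqrt 2\,]$ with norms $N\pi_2 = p$ and $N\rho_2 = q$, $$\Big(\frac{\lambda_p}{q}\Big) = \Big[\frac{\pi_2}{\rho_2}\Big] = \Big[\frac{\rho_2}{\pi_2}\Big] = \Big(\frac{\lambda_q}{p}\Big),$$ where $[\alpha/\beta]$ denotes the symbol modulo the prime ideal $(\beta)$ of $\mathbb Z[\sqrt 2\,]$. -/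

import Mathlib

open NumberField

/-- The quadratic residue symbol `[α/𝔭]` modulo a prime ideal `𝔭` with finite residue ring of odd
order: for `α ∉ 𝔭` it is the sign `±1` congruent to `α ^ ((N𝔭 - 1) / 2)` modulo `𝔭`, where
`N𝔭 = #(R ⧸ 𝔭)` (see `quadSymbol_sub_pow_mem`), and it is `0` for `α ∈ 𝔭`. -/
noncomputable def quadSymbol {R : Type*} [CommRing R] (α : R) (𝔭 : Ideal R) : ℤ :=
  open Classical in
  if α ∈ 𝔭 then 0
  else if α ^ ((Nat.card (R ⧸ 𝔭) - 1) / 2) - 1 ∈ 𝔭 then 1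
  else -1

/-- The congruence that characterizes the quadratic residue symbol. -/
theorem quadSymbol_sub_pow_mem {R : Type*} [CommRing R] (α : R) (𝔭 : Ideal R) [𝔭.IsPrime]
    [Finite (R ⧸ 𝔭)] (hodd : Odd (Nat.card (R ⧸ 𝔭))) (hα : α ∉ 𝔭) :
    (quadSymbol α 𝔭 : R) - α ^ ((Nat.card (R ⧸ 𝔭) - 1) / 2) ∈ 𝔭 := by
  classical
  have hsq : α ^ (Nat.card (R ⧸ 𝔭) - 1) - 1 ∈ 𝔭 := by
    have : Fintype (R ⧸ 𝔭) := Fintype.ofFinite _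
    have hf : IsField (R ⧸ 𝔭) := Finite.isField_of_domain _
    letI := hf.toField
    rw [← Ideal.Quotient.eq, map_pow, map_one, Nat.card_eq_fintype_card]
    exact FiniteField.pow_card_sub_one_eq_one _
      (fun h => hα (Ideal.Quotient.eq_zero_iff_mem.mp h))
  unfold quadSymbol
  rw [if_neg hα]
  split_ifs with h
  · have := 𝔭.neg_mem h
    simpa using this
  · obtain ⟨k, hk⟩ := hodd
    have e1 : Nat.card (R ⧸ 𝔭) - 1 = k * 2 := by omega
    have e2 : (Nat.card (R ⧸ 𝔭) - 1) / 2 = k := by omega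
    rw [e2] at h ⊢
    rw [e1, pow_mul] at hsq
    have hm : (α ^ k - 1) * (α ^ k + 1) ∈ 𝔭 := by
      convert hsq using 1
      ring
    have h2 := (Ideal.IsPrime.mem_or_mem ‹𝔭.IsPrime› hm).resolve_left h
    have := 𝔭.neg_mem h2
    convert this using 1
    push_cast
    ring

/-- `α` is totally positive: it is positive under every real embedding of `K`. -/
def TotallyPos {K : Type*} [Field K] (α : 𝓞 K) : Prop :=
  ∀ φ : K →+* ℝ, 0 < φ (α : K)

/-- `ε` is a fundamental unit of a real quadratic field: every unit is `± ε ^ n` for some `n ∈ ℤ`.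
(The fundamental units in this sense are `ε, -ε, ε⁻¹, -ε⁻¹`.) -/
def IsFundamentalUnit {K : Type*} [Field K] (ε : (𝓞 K)ˣ) : Prop :=
  ∀ u : (𝓞 K)ˣ, ∃ n : ℤ, u = ε ^ n ∨ u = -ε ^ n

/-- `𝔩` is a prime ideal of the ring `R` above the rational prime `ℓ`. -/
def IsPrimeAbove {R : Type*} [CommRing R] (𝔩 : Ideal R) (ℓ : ℕ) : Prop :=
  𝔩.IsPrime ∧ (ℓ : R) ∈ 𝔩

/-- `lam` is an admissible choice of the element `λ_p` in the quadratic field `K = ℚ(√p)`: it is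
totally positive and generates `𝔩 ^ h` for a prime ideal `𝔩` above `2`, where `h` is the class
number of `K`. -/
def IsLambda {K : Type*} [Field K] [NumberField K] (lam : 𝓞 K) : Prop :=
  TotallyPos lam ∧
    ∃ 𝔩 : Ideal (𝓞 K), IsPrimeAbove 𝔩 2 ∧ 𝔩 ^ classNumber K = Ideal.span {lam}

/-!
The symbols `(λ_p/q)` and `[π₂/ρ₂]` reduce to one reciprocity law for rational integers. If
`X² - 2Z² = pY²` and `c² - 2d² = q`, then multiplicativity of the norm form of `ℤ[√2]` gives
`p q Y² = (Xc - 2Zd)² - 2e²` with `e = Xd - Zc`. Hence `p q` is a square modulo the odd part of `e`,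
and the reciprocity law of the Jacobi symbol yields `(e/p) = (e/q)` (`legendreSym_cross_eq`). Reading
`e` modulo primes of norm `p` and `q` of `ℤ[√2]` turns this into a reciprocity between the symbols of
`X + Z√2` and `c + d√2` (`quadraticChar_add_mul_sqrtTwo`). With `Y = 1` it is `[π₂/ρ₂] = [ρ₂/π₂]`.

For `λ_p = (x + y√p)/2` one has `x² - py² = 4 N λ_p = 4 · 2 ^ h`, which is `2z²` for a power `z` of
`2` because the class number `h` of `ℚ(√p)` is odd. The identity
`2 (x + y√p) (x + z√2) = (x + y√p + z√2)²` then shows that `λ_p` and `x + z√2` have the same symbol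
modulo `q`, and `x² - 2z² = py²`, so that the reciprocity law gives `(λ_p/q) = [ρ₂/π₂]`
(`quadSymbol_lambda_eq`). Exchanging `p` and `q` gives `(λ_q/p) = [π₂/ρ₂]`.

The oddness of `h` (`odd_classNumber`) rests on an elementary form of genus theory: an ideal of
`ℚ(√p)` whose square is generated by a rational integer is principal, since `p` is the only ramified
prime (`exists_generator_of_sq_eq_span_nat`). Applied to `1 + ε` this shows that the fundamental unit
`ε` has norm `-1`, and with such a unit it shows that no ideal class has order `2`.
-/

open NumberField

/-! ### The Legendre symbol of a cross determinant -/

/-- For primes `r ≡ 1 mod 8` both `-1` and `2` are squares modulo `r`, so only the odd part `e'` of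
`|e|` contributes to `(e/r)`, and quadratic reciprocity turns `(e'/r)` into `(r/e')`. The same `e'`
serves all such `r`. -/
theorem exists_odd_dvd_legendreSym_eq_jacobiSym {e : ℤ} (he : e ≠ 0) :
    ∃ e' : ℕ, Odd e' ∧ (e' : ℤ) ∣ e ∧
      ∀ r : ℕ, [Fact r.Prime] → r % 8 = 1 → legendreSym r e = jacobiSym r e' := by
  obtain ⟨k, m, hm, hkm⟩ := Nat.exists_eq_two_pow_mul_odd (n := e.natAbs) (by simpa using he)
  refine ⟨m, hm, ?_, ?_⟩
  · rw [Int.natCast_dvd, hkm]; exact dvd_mul_left _ _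
  · intro r hr hr8
    have hr2 : r ≠ 2 := by rintro rfl; omega
    have h1 : legendreSym r (-1) = 1 := by
      rw [legendreSym.at_neg_one hr2, ZMod.χ₄_nat_one_mod_four (by omega)]
    have h2 : legendreSym r 2 = 1 := by
      rw [legendreSym.at_two hr2, ZMod.χ₈_nat_eq_if_mod_eight]
      simp [hr8]; omega
    have h3 : legendreSym r (e.natAbs : ℤ) = legendreSym r e := by
      rcases Int.natAbs_eq e with h | h
      · rw [← h]
      · conv_rhs => rw [h, neg_eq_neg_one_mul, legendreSym.mul, h1, one_mul]
    rw [← h3, hkm]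
    push_cast
    rw [legendreSym.mul]
    have h4 : legendreSym r (2 ^ k) = 1 := by
      have : legendreSym r (2 ^ k) = legendreSym r 2 ^ k := map_pow (legendreSym.hom r) 2 k
      rw [this, h2, one_pow]
    rw [h4, one_mul, jacobiSym.legendreSym.to_jacobiSym]
    exact jacobiSym.quadratic_reciprocity_one_mod_four' hm (by omega)

theorem not_dvd_both_of_norm_prime {p r : ℕ} (hp : p.Prime) (hr : r.Prime) {a b : ℤ}
    (h : a ^ 2 - 2 * b ^ 2 = p) (ha : (r : ℤ) ∣ a) (hb : (r : ℤ) ∣ b) : False := by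
  obtain ⟨a, rfl⟩ := ha
  obtain ⟨b, rfl⟩ := hb
  have h2 : r * r ∣ p := by
    have : ((r * r : ℕ) : ℤ) ∣ (p : ℤ) := ⟨a ^ 2 - 2 * b ^ 2, by rw [← h]; push_cast; ring⟩
    exact_mod_cast this
  exact hr.one_lt.ne' (Nat.isUnit_iff.mp (hp.prime.squarefree r h2))

theorem not_dvd_snd_of_norm_prime {p : ℕ} (hp : p.Prime) {a b : ℤ}
    (h : a ^ 2 - 2 * b ^ 2 = p) : ¬ (p : ℤ) ∣ b := by
  intro hb
  refine not_dvd_both_of_norm_prime hp hp h ?_ hb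
  refine (Nat.prime_iff_prime_int.mp hp).dvd_of_dvd_pow (n := 2) ?_
  have : a ^ 2 = p + 2 * b * b := by linarith
  rw [this]
  exact dvd_add dvd_rfl (hb.mul_left _)

/-- If `p = a² - 2b²`, then `p` is a square modulo the odd part of `b`, whence `(b/p) = 1`. -/
theorem legendreSym_snd_of_norm {p : ℕ} [hp : Fact p.Prime] (hp8 : p % 8 = 1) {a b : ℤ}
    (h : a ^ 2 - 2 * b ^ 2 = p) : legendreSym p b = 1 := by
  have hb0 : b ≠ 0 := by
    rintro rfl
    exact not_dvd_snd_of_norm_prime hp.out h (dvd_zero _)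
  obtain ⟨b', -, hdvd, hsym⟩ := exists_odd_dvd_legendreSym_eq_jacobiSym hb0
  rw [hsym p hp8]
  have hcop : IsCoprime a (b' : ℤ) := by
    rw [Int.isCoprime_iff_gcd_eq_one]
    refine Nat.eq_one_iff_not_exists_prime_dvd.mpr fun r hr hrd => ?_
    have hr' : (r : ℤ) ∣ (Int.gcd a b' : ℤ) := by exact_mod_cast hrd
    exact not_dvd_both_of_norm_prime hp.out hr h (hr'.trans (Int.gcd_dvd_left _ _))
      ((hr'.trans (Int.gcd_dvd_right _ _)).trans hdvd)
  have hmod : jacobiSym p b' = jacobiSym (a ^ 2) b' := by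
    apply jacobiSym.mod_left'
    apply Int.ModEq.symm
    rw [Int.modEq_iff_dvd, ← h]
    have : a ^ 2 - 2 * b ^ 2 - a ^ 2 = b * (-2 * b) := by ring
    rw [this]
    exact hdvd.mul_right _
  rw [hmod]
  exact jacobiSym.sq_one' (Int.isCoprime_iff_gcd_eq_one.mp hcop)

/-- The reciprocity law behind everything else. With `e = Xd - Zc` and `W = Xc - 2Zd` the norm form
is multiplicative, `p q Y² = W² - 2e²`, so `p q` is a square modulo the odd part `e'` of `e`:
`(p/e') = (q/e')`, which is `(e/p) = (e/q)`. The hypotheses on common divisors make `p q Y²`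
coprime to `e'`. -/
theorem legendreSym_cross_eq {p q : ℕ} [hp : Fact p.Prime] [hq : Fact q.Prime]
    (hp8 : p % 8 = 1) (hq8 : q % 8 = 1) (hne : p ≠ q) {X Z Y c d : ℤ}
    (hX : X ^ 2 - 2 * Z ^ 2 = p * Y ^ 2) (hc : c ^ 2 - 2 * d ^ 2 = q)
    (hpZ : ¬ (p : ℤ) ∣ Z) (hXZ : ∀ r : ℕ, r.Prime → Odd r → (r : ℤ) ∣ X → (r : ℤ) ∣ Z → False)
    (hqe : ¬ (q : ℤ) ∣ X * d - Z * c) :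
    legendreSym q (X * d - Z * c) = legendreSym p (X * d - Z * c) := by
  have he0 : X * d - Z * c ≠ 0 := fun h => hqe (h ▸ dvd_zero _)
  obtain ⟨e', hodd, hdvd, hsym⟩ := exists_odd_dvd_legendreSym_eq_jacobiSym he0
  set e := X * d - Z * c with he
  set W := X * c - 2 * Z * d with hW
  have hmain : (p : ℤ) * q * Y ^ 2 = W ^ 2 - 2 * e ^ 2 := by
    have : (p : ℤ) * q * Y ^ 2 = (p * Y ^ 2) * q := by ring
    rw [this, ← hX, ← hc, he, hW]; ring
  have hcop : IsCoprime ((p : ℤ) * q * Y ^ 2) (e' : ℤ) := by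
    rw [Int.isCoprime_iff_gcd_eq_one]
    refine Nat.eq_one_iff_not_exists_prime_dvd.mpr fun r hr hrd => ?_
    have hr' : (r : ℤ) ∣ (Int.gcd ((p : ℤ) * q * Y ^ 2) e' : ℤ) := by exact_mod_cast hrd
    have hr1 := hr'.trans (Int.gcd_dvd_left _ _)
    have hr2 := hr'.trans (Int.gcd_dvd_right _ _)
    have hre : (r : ℤ) ∣ e := hr2.trans hdvd
    have hrodd : Odd r := hodd.of_dvd_nat (by exact_mod_cast hr2)
    have hri := Nat.prime_iff_prime_int.mp hr
    have hrq : r ≠ q := by rintro rfl; exact hqe hre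
    have hrq' : ¬ (r : ℤ) ∣ q := fun h =>
      hrq ((Nat.prime_dvd_prime_iff_eq hr hq.out).mp (by exact_mod_cast h))
    have hrW : (r : ℤ) ∣ W := by
      refine hri.dvd_of_dvd_pow (n := 2) ?_
      have : W ^ 2 = (p : ℤ) * q * Y ^ 2 + 2 * e * e := by rw [hmain]; ring
      rw [this]
      exact dvd_add hr1 (hre.mul_left _)
    have hrZ : (r : ℤ) ∣ Z := by
      have : Z * q = d * W - c * e := by rw [← hc, he, hW]; ring
      have h3 : (r : ℤ) ∣ Z * q := this ▸ dvd_sub (hrW.mul_left _) (hre.mul_left _)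
      exact (hri.dvd_or_dvd h3).resolve_right hrq'
    rcases hri.dvd_or_dvd hr1 with h | h
    · rcases hri.dvd_or_dvd h with h | h
      · have : r = p := (Nat.prime_dvd_prime_iff_eq hr hp.out).mp (by exact_mod_cast h)
        exact hpZ (this ▸ hrZ)
      · exact hrq' h
    · refine hXZ r hr hrodd ?_ hrZ
      refine hri.dvd_of_dvd_pow (n := 2) ?_
      have : X ^ 2 = p * Y ^ 2 + 2 * Z * Z := by rw [← hX]; ring
      rw [this]
      exact dvd_add (h.mul_left _) (hrZ.mul_left _)
  have hprod : jacobiSym ((p : ℤ) * q * Y ^ 2) e' = 1 := by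
    have hmod : jacobiSym ((p : ℤ) * q * Y ^ 2) e' = jacobiSym (W ^ 2) e' := by
      apply jacobiSym.mod_left'
      apply Int.ModEq.symm
      rw [Int.modEq_iff_dvd, hmain]
      have : W ^ 2 - 2 * e ^ 2 - W ^ 2 = e * (-2 * e) := by ring
      rw [this]
      exact hdvd.mul_right _
    rw [hmod]
    refine jacobiSym.sq_one' (Int.isCoprime_iff_gcd_eq_one.mp ?_)
    have h1 : IsCoprime (W ^ 2) (e' : ℤ) := by
      obtain ⟨f, hf⟩ := hdvd
      have : W ^ 2 = (p : ℤ) * q * Y ^ 2 + e' * (2 * f * e) := by rw [hmain, hf]; ring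
      rw [this]
      exact hcop.add_mul_left_left _
    exact (IsCoprime.pow_left_iff two_pos).mp h1
  have hY : jacobiSym (Y ^ 2) e' = 1 := by
    refine jacobiSym.sq_one' (Int.isCoprime_iff_gcd_eq_one.mp ?_)
    exact (IsCoprime.pow_left_iff two_pos).mp hcop.of_mul_left_right
  rw [jacobiSym.mul_left, jacobiSym.mul_left, hY, mul_one] at hprod
  rw [hsym q hq8, hsym p hp8]
  rcases Int.eq_one_or_neg_one_of_mul_eq_one' hprod with ⟨h1, h2⟩ | ⟨h1, h2⟩ <;> rw [h1, h2]

/-! ### Residue symbols of elements of `ℤ[√2]` -/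

theorem quadraticChar_neg_of_one_mod_eight {p : ℕ} [Fact p.Prime] (hp8 : p % 8 = 1)
    (x : ZMod p) : quadraticChar (ZMod p) (-x) = quadraticChar (ZMod p) x := by
  have hp2 : p ≠ 2 := by rintro rfl; omega
  have h1 : legendreSym p (-1) = 1 := by
    rw [legendreSym.at_neg_one hp2, ZMod.χ₄_nat_one_mod_four (by omega)]
  have h2 : quadraticChar (ZMod p) (-1) = 1 := by simpa [legendreSym] using h1
  rw [neg_eq_neg_one_mul, map_mul, h2, one_mul]

/-- The choice of `√2` modulo `q` is irrelevant for the symbol of an element of norm `p`: the product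
of the two values is `(p/q) = 1`. -/
theorem quadraticChar_conj_eq {p q : ℕ} [hp : Fact p.Prime] [hq : Fact q.Prime]
    (hne : p ≠ q) (hpq : IsSquare (p : ZMod q)) {a b : ℤ} (h : a ^ 2 - 2 * b ^ 2 = p)
    {t : ZMod q} (ht : t ^ 2 = 2) :
    quadraticChar (ZMod q) (a - b * t) = quadraticChar (ZMod q) (a + b * t) := by
  have hp0 : (p : ZMod q) ≠ 0 := by
    rw [Ne, ZMod.natCast_eq_zero_iff]
    exact fun h => hne ((Nat.prime_dvd_prime_iff_eq hq.out hp.out).mp h).symm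
  have hmul : ((a : ZMod q) - b * t) * (a + b * t) = p := by
    have : ((a : ZMod q)) ^ 2 - 2 * b ^ 2 = p := by exact_mod_cast congrArg (Int.cast (R := ZMod q)) h
    rw [← this, ← ht]; ring
  have h1 := (quadraticChar_one_iff_isSquare hp0).mpr hpq
  rw [← hmul, map_mul] at h1
  rcases Int.eq_one_or_neg_one_of_mul_eq_one' h1 with ⟨h1, h2⟩ | ⟨h1, h2⟩ <;> rw [h1, h2]

/-- Reciprocity between `X + Z√2`, whose norm is `p` up to a square, and `c + d√2` of norm `q`. If
`√2 ≡ -c/d` modulo `q`, then `X + Z√2 ≡ (Xd - Zc)/d`, where `(d/q) = 1`; modulo `p` one has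
`X ≡ ±Z√2` and `Xd - Zc ≡ Z(±d√2 - c)`. -/
theorem quadraticChar_add_mul_sqrtTwo {p q : ℕ} [hp : Fact p.Prime] [hq : Fact q.Prime]
    (hp8 : p % 8 = 1) (hq8 : q % 8 = 1) (hne : p ≠ q) (hqp : IsSquare (q : ZMod p))
    {X Z Y c d : ℤ}
    (hX : X ^ 2 - 2 * Z ^ 2 = p * Y ^ 2) (hc : c ^ 2 - 2 * d ^ 2 = q)
    (hpZ : ¬ (p : ℤ) ∣ Z) (hXZ : ∀ r : ℕ, r.Prime → Odd r → (r : ℤ) ∣ X → (r : ℤ) ∣ Z → False)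
    {t : ZMod q} (ht : t ^ 2 = 2) (h0 : (X : ZMod q) + Z * t ≠ 0)
    {τ : ZMod p} (hτ : τ ^ 2 = 2) :
    quadraticChar (ZMod q) (X + Z * t) =
      quadraticChar (ZMod p) Z * quadraticChar (ZMod p) (c + d * τ) := by
  -- replacing `d` by `-d` changes neither side
  wlog hct : (c : ZMod q) = -(d * t) generalizing d
  · have hd : c ^ 2 - 2 * (-d) ^ 2 = q := by rw [← hc]; ring
    have := this hd ?_
    · rw [this]
      congr 1
      push_cast
      rw [← quadraticChar_conj_eq hne.symm hqp hc hτ]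
      congr 1; ring
    · have h2 : (c : ZMod q) ^ 2 - 2 * d ^ 2 = 0 := by
        have := congrArg (Int.cast (R := ZMod q)) hc
        push_cast at this
        rw [this]; simp
      have h3 : ((c : ZMod q) - d * t) * (c + d * t) = 0 := by
        rw [← h2, ← ht]; ring
      rcases mul_eq_zero.mp h3 with h | h
      · push_cast; linear_combination h
      · exact absurd (by linear_combination h) hct
  have hdq : (d : ZMod q) ≠ 0 := by
    rw [Ne, ZMod.intCast_zmod_eq_zero_iff_dvd]
    exact not_dvd_snd_of_norm_prime hq.out hc
  have hcast : ((X * d - Z * c : ℤ) : ZMod q) = d * (X + Z * t) := by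
    push_cast; rw [hct]; ring
  have hqe : ¬ (q : ℤ) ∣ X * d - Z * c := by
    rw [← ZMod.intCast_zmod_eq_zero_iff_dvd, hcast]
    exact mul_ne_zero hdq h0
  have key := legendreSym_cross_eq hp8 hq8 hne hX hc hpZ hXZ hqe
  have hl : legendreSym q (X * d - Z * c) = quadraticChar (ZMod q) (X + Z * t) := by
    have hd1 : quadraticChar (ZMod q) (d : ZMod q) = 1 := legendreSym_snd_of_norm hq8 hc
    rw [legendreSym, hcast, map_mul, hd1, one_mul]
  rw [← hl, key, legendreSym, ← map_mul]
  have h2 : ((X : ZMod p) - Z * τ) * (X + Z * τ) = 0 := by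
    have := congrArg (Int.cast (R := ZMod p)) hX
    push_cast at this
    have h3 : (X : ZMod p) ^ 2 - 2 * Z ^ 2 = 0 := by rw [this]; simp
    rw [← h3, ← hτ]; ring
  rcases mul_eq_zero.mp h2 with h | h
  · have : ((X * d - Z * c : ℤ) : ZMod p) = -(Z * (c - d * τ)) := by
      push_cast; linear_combination d * h
    rw [this, quadraticChar_neg_of_one_mod_eight hp8, map_mul, map_mul,
      quadraticChar_conj_eq hne.symm hqp hc hτ]
  · have : ((X * d - Z * c : ℤ) : ZMod p) = -(Z * (c + d * τ)) := by
      push_cast; linear_combination d * h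
    rw [this, quadraticChar_neg_of_one_mod_eight hp8]

/-- Quadratic reciprocity in `ℤ[√2]` for two elements of norms `p` and `q`. -/
theorem quadraticChar_reciprocity {p q : ℕ} [hp : Fact p.Prime] [hq : Fact q.Prime]
    (hp8 : p % 8 = 1) (hq8 : q % 8 = 1) (hne : p ≠ q) (hqp : IsSquare (q : ZMod p))
    {a b c d : ℤ} (ha : a ^ 2 - 2 * b ^ 2 = p) (hc : c ^ 2 - 2 * d ^ 2 = q)
    {t : ZMod q} (ht : t ^ 2 = 2) {τ : ZMod p} (hτ : τ ^ 2 = 2) :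
    quadraticChar (ZMod q) (a + b * t) = quadraticChar (ZMod p) (c + d * τ) := by
  have hb1 : quadraticChar (ZMod p) (b : ZMod p) = 1 := legendreSym_snd_of_norm hp8 ha
  rw [quadraticChar_add_mul_sqrtTwo hp8 hq8 hne hqp (Y := 1) (by rw [ha]; ring) hc
    (not_dvd_snd_of_norm_prime hp.out ha)
    (fun r hr _ => not_dvd_both_of_norm_prime hp.out hr ha) ht ?_ hτ, hb1, one_mul]
  intro h0
  have h1 : ((a : ZMod q) - b * t) * (a + b * t) = p := by
    have : ((a : ZMod q)) ^ 2 - 2 * b ^ 2 = p := by exact_mod_cast congrArg (Int.cast (R := ZMod q)) ha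
    rw [← this, ← ht]; ring
  rw [h0, mul_zero, eq_comm, ZMod.natCast_eq_zero_iff] at h1
  exact hne ((Nat.prime_dvd_prime_iff_eq hq.out hp.out).mp h1).symm

/-- Thue's argument: the pigeonhole principle gives `u ≡ v√2 mod p`, not both zero, with
`u², v² < p`. Then `u² - 2v²` is a multiple of `p` strictly between `-2p` and `p` and nonzero, hence
`-p`, and multiplication by the unit `1 + √2` of norm `-1` changes the sign. -/
theorem exists_norm_eq_prime {p : ℕ} [hp : Fact p.Prime] (hp8 : p % 8 = 1) :
    ∃ a b : ℤ, a ^ 2 - 2 * b ^ 2 = p := by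
  have hp2 : p ≠ 2 := by rintro rfl; omega
  obtain ⟨τ, hτ⟩ := (ZMod.exists_sq_eq_two_iff hp2).mpr (Or.inl hp8)
  set n := Nat.sqrt p with hn
  have hn1 : n * n < p := by
    refine lt_of_le_of_ne (Nat.sqrt_le p) fun h => ?_
    exact hp.out.prime.not_isSquare ⟨n, h.symm⟩
  have hn2 : p < (n + 1) * (n + 1) := Nat.lt_succ_sqrt p
  let S := Finset.range (n + 1) ×ˢ Finset.range (n + 1)
  let f : ℕ × ℕ → ZMod p := fun x => x.1 - τ * x.2
  obtain ⟨x, hx, y, hy, hxy, hf⟩ := Finset.exists_ne_map_eq_of_card_lt_of_maps_to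
    (s := S) (t := Finset.univ) (f := f) (by simpa [S, ZMod.card] using hn2) (fun _ _ => by simp)
  simp only [S, Finset.mem_product, Finset.mem_range] at hx hy
  set u : ℤ := (x.1 : ℤ) - y.1 with hu
  set v : ℤ := (x.2 : ℤ) - y.2 with hv
  have hn1' : (n : ℤ) * n < p := by exact_mod_cast hn1
  have hu2 : u ^ 2 < p := by
    have : u ^ 2 ≤ (n : ℤ) ^ 2 := sq_le_sq' (by omega) (by omega)
    nlinarith
  have hv2 : v ^ 2 < p := by
    have : v ^ 2 ≤ (n : ℤ) ^ 2 := sq_le_sq' (by omega) (by omega)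
    nlinarith
  have hdvd : (p : ℤ) ∣ u ^ 2 - 2 * v ^ 2 := by
    rw [← ZMod.intCast_zmod_eq_zero_iff_dvd, hu, hv]
    push_cast
    have h1 : ((x.1 : ZMod p) - y.1) = τ * (x.2 - y.2) := by
      simp only [f] at hf
      linear_combination hf
    rw [h1, hτ]; ring
  obtain ⟨k, hk⟩ := hdvd
  have hp0 : (0 : ℤ) < p := by exact_mod_cast hp.out.pos
  have hk1 : k < 1 := by
    by_contra h
    have : (p : ℤ) * 1 ≤ p * k := by gcongr; omega
    nlinarith [sq_nonneg v]
  have hk2 : -2 < k := by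
    by_contra h
    have : (p : ℤ) * k ≤ p * (-2) := by gcongr; omega
    nlinarith [sq_nonneg u]
  have hk0 : k ≠ 0 := by
    rintro rfl
    have h2 : u * u = 2 * (v * v) := by linear_combination hk
    have : Zsqrtd.Nonsquare 2 := ⟨fun m hm => by
      have : m ≤ 1 := by nlinarith
      interval_cases m <;> omega⟩
    obtain ⟨hu0, hv0⟩ := Zsqrtd.divides_sq_eq_zero_z (d := 2) (x := u) (y := v)
      (by push_cast; linear_combination h2)
    apply hxy
    ext <;> omega
  obtain rfl : k = -1 := by omega
  exact ⟨u + 2 * v, u + v, by linear_combination -hk⟩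

/-! ### Integers of the quadratic field of prime discriminant -/

section QuadraticField

theorem nonsquare_of_prime {p : ℕ} (hp : p.Prime) : Zsqrtd.Nonsquare p :=
  ⟨fun n h => hp.prime.not_isSquare ⟨n, h⟩⟩

variable {K : Type*} [Field K] [NumberField K]

/-- The element `ω = (1 + √p)/2`. In what follows `√p` is written `2ω - 1`. -/
theorem exists_half_one_add_sqrt {p c : ℕ} (hpc : p = 4 * c + 1) (hK : IsSquare (p : K)) :
    ∃ ω : 𝓞 K, ω ^ 2 = ω + c := by
  obtain ⟨r, hr⟩ := hK
  have hw : ((1 + r) / 2) ^ 2 = (1 + r) / 2 + (c : K) := by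
    have : (p : K) = 4 * c + 1 := by rw [hpc]; push_cast; ring
    rw [this] at hr
    linear_combination -hr / 4
  have hint : IsIntegral ℤ ((1 + r) / 2) := by
    refine ⟨Polynomial.X ^ 2 - (Polynomial.X + Polynomial.C (c : ℤ)), ?_, ?_⟩
    · apply Polynomial.monic_X_pow_sub
      rw [Polynomial.degree_X_add_C]; norm_num
    · simp [hw]
  obtain ⟨ω, hω⟩ : ∃ ω : 𝓞 K, algebraMap (𝓞 K) K ω = (1 + r) / 2 := ⟨⟨_, hint⟩, rfl⟩
  refine ⟨ω, FaithfulSMul.algebraMap_injective (𝓞 K) K ?_⟩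
  rw [map_pow, map_add, map_natCast, hω, hw]

variable {p c : ℕ} {ω : 𝓞 K}

theorem two_mul_sub_one_sq (hpc : p = 4 * c + 1) (hω : ω ^ 2 = ω + c) :
    (2 * ω - 1) ^ 2 = (p : 𝓞 K) := by
  rw [hpc]; push_cast; linear_combination 4 * hω

theorem coe_two_mul_sub_one_sq (hpc : p = 4 * c + 1) (hω : ω ^ 2 = ω + c) :
    (2 * ω - 1 : K) ^ 2 = p := by
  have := congrArg (algebraMap (𝓞 K) K) (two_mul_sub_one_sq hpc hω)
  simpa only [map_pow, map_sub, map_mul, map_one, map_ofNat, map_natCast] using this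

theorem coords_eq_zero (hp : p.Prime) (hpc : p = 4 * c + 1) (hω : ω ^ 2 = ω + c) {m n : ℤ}
    (h : (m : 𝓞 K) + n * ω = 0) : m = 0 ∧ n = 0 := by
  have := nonsquare_of_prime hp
  have h1 : (2 * m + n) * (2 * m + n) = p * n * n := by
    have h2 : ((2 * m + n) * (2 * m + n) : 𝓞 K) = p * n * n := by
      rw [hpc]; push_cast
      linear_combination (4 * (m : 𝓞 K) - 4 * n * ω + 4 * n) * h + 4 * n ^ 2 * hω
    exact_mod_cast h2
  have h2 := Zsqrtd.divides_sq_eq_zero_z h1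
  omega

/-- A nontrivial solution of the Pell equation is a unit of infinite order. -/
theorem exists_unit_pow_ne_one (hp : p.Prime) (hpc : p = 4 * c + 1) (hω : ω ^ 2 = ω + c)
    (φ : K →+* ℝ) : ∃ u : (𝓞 K)ˣ, ∀ n : ℕ, n ≠ 0 → u ^ n ≠ 1 := by
  obtain ⟨x, y, hxy, hy⟩ := Pell.exists_of_not_isSquare (d := p) (by exact_mod_cast hp.pos)
    (Nat.prime_iff_prime_int.mp hp).not_isSquare
  have hxy' : (x : 𝓞 K) ^ 2 - p * y ^ 2 = 1 := by exact_mod_cast congrArg (Int.cast (R := 𝓞 K)) hxy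
  have hs : (2 * ω - 1) ^ 2 = (p : 𝓞 K) := two_mul_sub_one_sq hpc hω
  have hmul : (x + y * (2 * ω - 1)) * (x - y * (2 * ω - 1)) = 1 := by
    linear_combination hxy' - (y : 𝓞 K) ^ 2 * hs
  refine ⟨Units.mkOfMulEqOne _ _ hmul, fun n hn h => ?_⟩
  have h1 : (x + y * (2 * ω - 1)) ^ n = 1 := by
    have := congrArg Units.val h
    simpa using this
  -- a real number some positive power of which is `1` is `1` or `-1`
  have h2 : |φ (algebraMap (𝓞 K) K (x + y * (2 * ω - 1)))| = 1 := by
    rw [← pow_eq_one_iff_of_nonneg (abs_nonneg _) hn, ← abs_pow, ← map_pow, ← map_pow, h1]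
    simp
  have h3 : ∃ e : ℤ, (x + y * (2 * ω - 1) : 𝓞 K) = e := by
    have hinj : Function.Injective (fun a : 𝓞 K => φ (algebraMap (𝓞 K) K a)) :=
      φ.injective.comp (FaithfulSMul.algebraMap_injective (𝓞 K) K)
    rcases (abs_eq zero_le_one).mp h2 with h | h
    · exact ⟨1, hinj (by simp only [h]; simp)⟩
    · exact ⟨-1, hinj (by simp only [h]; simp)⟩
  obtain ⟨e, he⟩ := h3
  have h4 := coords_eq_zero hp hpc hω (m := x - y - e) (n := 2 * y)
    (by push_cast; linear_combination he)
  omega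

variable [Algebra.IsQuadraticExtension ℚ K]

/-- The nontrivial automorphism, through its relation to norm and trace. -/
theorem exists_conj (hp : p.Prime) (hpc : p = 4 * c + 1) (hω : ω ^ 2 = ω + c) :
    ∃ σ : K ≃ₐ[ℚ] K, σ (2 * ω - 1 : K) = -(2 * ω - 1) ∧
      (∀ x : K, algebraMap ℚ K (Algebra.norm ℚ x) = x * σ x) ∧
      ∀ x : K, algebraMap ℚ K (Algebra.trace ℚ K x) = x + σ x := by
  classical
  have hcard : Fintype.card (K ≃ₐ[ℚ] K) = 2 := by
    rw [← Nat.card_eq_fintype_card, IsGalois.card_aut_eq_finrank,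
      Algebra.IsQuadraticExtension.finrank_eq_two]
  have : Nontrivial (K ≃ₐ[ℚ] K) := Fintype.one_lt_card_iff_nontrivial.mp (by omega)
  obtain ⟨σ, hσ⟩ := exists_ne (1 : K ≃ₐ[ℚ] K)
  have huniv : (Finset.univ : Finset (K ≃ₐ[ℚ] K)) = {1, σ} := by
    symm
    apply Finset.eq_of_subset_of_card_le (Finset.subset_univ _)
    rw [Finset.card_pair hσ.symm, Finset.card_univ, hcard]
  have hs : (2 * ω - 1 : K) ^ 2 = p := coe_two_mul_sub_one_sq hpc hω
  refine ⟨σ, ?_, ?_, ?_⟩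
  · have h1 : (σ (2 * ω - 1 : K) - (2 * ω - 1)) * (σ (2 * ω - 1 : K) + (2 * ω - 1)) = 0 := by
      have : σ (2 * ω - 1 : K) ^ 2 = p := by rw [← map_pow, hs]; simp
      linear_combination this - hs
    rcases mul_eq_zero.mp h1 with h | h
    · exfalso
      have hbot : (2 * ω - 1 : K) ∈ (⊥ : IntermediateField ℚ K) := by
        rw [IsGalois.mem_bot_iff_fixed]
        intro f
        have : f ∈ ({1, σ} : Finset (K ≃ₐ[ℚ] K)) := huniv ▸ Finset.mem_univ f
        rcases Finset.mem_insert.mp this with rfl | h'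
        · rfl
        · rw [Finset.mem_singleton.mp h']; exact sub_eq_zero.mp h
      obtain ⟨r, hr⟩ := IntermediateField.mem_bot.mp hbot
      rw [← hr, ← map_pow] at hs
      have : r ^ 2 = p := (algebraMap ℚ K).injective (by rw [hs]; simp)
      exact hp.prime.not_isSquare (Rat.isSquare_natCast_iff.mp ⟨r, by rw [← this, sq]⟩)
    · exact eq_neg_of_add_eq_zero_left h
  · intro x
    rw [Algebra.norm_eq_prod_automorphisms, huniv, Finset.prod_pair hσ.symm]; rfl
  · intro x
    rw [trace_eq_sum_automorphisms, huniv, Finset.sum_pair hσ.symm]; rfl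

/-- Every integer is `(x + y√p)/2`, where `x` is its trace. That `y` is an integer follows by taking
the trace `k = p y` of `√p α`, since `k² = p (x² - 4 N α)` forces `p ∣ k`. -/
theorem exists_half_coords (hp : p.Prime) (hpc : p = 4 * c + 1) (hω : ω ^ 2 = ω + c) (α : 𝓞 K) :
    ∃ x y : ℤ, 2 * α = x + y * (2 * ω - 1) ∧ x ^ 2 - p * y ^ 2 = 4 * Algebra.norm ℤ α ∧
      α ^ 2 = x * α - (Algebra.norm ℤ α : ℤ) := by
  obtain ⟨σ, hσs, hN, hT⟩ := exists_conj hp hpc hω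
  have hs : (2 * ω - 1 : K) ^ 2 = p := coe_two_mul_sub_one_sq hpc hω
  have hs0 : (2 * ω - 1 : K) ≠ 0 := by
    intro h
    rw [h] at hs
    exact hp.ne_zero (by exact_mod_cast (show (p : K) = 0 by rw [← hs]; ring))
  set N := Algebra.norm ℤ α with hNdef
  set T := Algebra.trace ℤ (𝓞 K) α with hTdef
  set k := Algebra.trace ℤ (𝓞 K) ((2 * ω - 1) * α) with hkdef
  have h1 : (N : K) = α * σ α := by
    rw [← hN, ← Algebra.coe_norm_int]; simp [hNdef]
  have h2 : (T : K) = α + σ α := by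
    rw [← hT, ← Algebra.coe_trace_int]; simp [hTdef]
  have h3 : (k : K) = (2 * ω - 1) * (α - σ α) := by
    have h4 : (((2 * ω - 1) * α : 𝓞 K) : K) = (2 * ω - 1) * α := by
      simp only [map_mul, map_sub, map_one, map_ofNat]
    have : (k : K) = (2 * ω - 1) * α + σ ((2 * ω - 1) * α) := by
      rw [← hT, ← h4, ← Algebra.coe_trace_int]; simp [hkdef]
    rw [this, map_mul, hσs]; ring
  have h4 : k ^ 2 = p * (T ^ 2 - 4 * N) := by
    have : (k : K) ^ 2 = p * ((T : K) ^ 2 - 4 * N) := by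
      rw [h3, mul_pow, hs, h1, h2]; ring
    exact_mod_cast this
  have hpk : (p : ℤ) ∣ k :=
    (Nat.prime_iff_prime_int.mp hp).dvd_of_dvd_pow (n := 2) ⟨_, h4⟩
  obtain ⟨y, hy⟩ := hpk
  have hp0 : (p : ℤ) ≠ 0 := by exact_mod_cast hp.ne_zero
  have h5 : p * y ^ 2 = T ^ 2 - 4 * N := by
    apply mul_left_cancel₀ hp0
    rw [← h4, hy]; ring
  have h6 : (α : K) - σ α = y * (2 * ω - 1) := by
    apply mul_left_cancel₀ hs0
    rw [← h3, hy]; push_cast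
    linear_combination (-y : K) * hs
  refine ⟨T, y, ?_, by rw [h5]; ring, ?_⟩
  · apply RingOfIntegers.ext
    simp only [map_mul, map_add, map_sub, map_one, map_ofNat, map_intCast]
    linear_combination h6 - h2
  · apply RingOfIntegers.ext
    simp only [map_mul, map_sub, map_pow, map_intCast]
    linear_combination h1 - (α : K) * h2

theorem exists_coords (hp : p.Prime) (hpc : p = 4 * c + 1) (hω : ω ^ 2 = ω + c) (α : 𝓞 K) :
    ∃ m n : ℤ, α = m + n * ω := by
  obtain ⟨x, y, h1, h2, -⟩ := exists_half_coords hp hpc hω α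
  have h3 : Even (x - y) := by
    have : Even (x ^ 2 - p * y ^ 2) := ⟨2 * Algebra.norm ℤ α, by rw [h2]; ring⟩
    rw [hpc] at this
    have h4 : ¬ Odd (4 * (c : ℤ)) := Int.not_odd_iff_even.mpr ⟨2 * c, by ring⟩
    simpa [h4, Int.even_sub, Int.even_mul, Int.even_pow, Int.even_add, parity_simps] using this
  obtain ⟨m, hm⟩ := h3
  refine ⟨m, y, mul_left_cancel₀ (two_ne_zero' (𝓞 K)) ?_⟩
  have : ((x - y : ℤ) : 𝓞 K) = m + m := by rw [hm]; push_cast; ring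
  push_cast at this
  linear_combination h1 + this

/-- The image of `√p` in `ℂ` has a positive square, hence is real. -/
theorem exists_real_embedding (hp : p.Prime) (hpc : p = 4 * c + 1) (hω : ω ^ 2 = ω + c) :
    Nonempty (K →+* ℝ) := by
  obtain ⟨φ⟩ : Nonempty (K →+* ℂ) := inferInstance
  have hreal : (starRingEnd ℂ) (φ ω) = φ ω := by
    have hs : (2 * φ ω - 1) ^ 2 = p := by
      simpa only [map_pow, map_sub, map_mul, map_one, map_ofNat, map_natCast] using
        congrArg φ (coe_two_mul_sub_one_sq hpc hω)
    rw [Complex.conj_eq_iff_im]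
    have h1 := congrArg Complex.re hs
    have h2 := congrArg Complex.im hs
    simp [sq] at h1 h2
    have h3 : ((2 * (φ ω).re - 1) * 4) * (φ ω).im = 0 := by linear_combination h2
    rcases mul_eq_zero.mp h3 with h | h
    · have : (0 : ℝ) < p := by exact_mod_cast hp.pos
      have h4 : 2 * (φ ω).re - 1 = 0 := by linarith
      rw [h4] at h1
      nlinarith [sq_nonneg (φ ω).im]
    · exact h
  refine ⟨ComplexEmbedding.IsReal.embedding (φ := φ) ?_⟩
  rw [ComplexEmbedding.isReal_iff]
  refine IsFractionRing.ringHom_ext (A := 𝓞 K) fun α => ?_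
  obtain ⟨m, n, rfl⟩ := exists_coords hp hpc hω α
  simp [ComplexEmbedding.conjugate_coe_eq, hreal]
theorem dvd_coords_iff (hp : p.Prime) (hpc : p = 4 * c + 1) (hω : ω ^ 2 = ω + c) {r m n : ℤ} :
    (r : 𝓞 K) ∣ m + n * ω ↔ r ∣ m ∧ r ∣ n := by
  constructor
  · rintro ⟨β, hβ⟩
    obtain ⟨m', n', rfl⟩ := exists_coords hp hpc hω β
    have : ((m - r * m' : ℤ) : 𝓞 K) + ((n - r * n' : ℤ) : 𝓞 K) * ω = 0 := by
      push_cast; linear_combination hβ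
    obtain ⟨h1, h2⟩ := coords_eq_zero hp hpc hω this
    exact ⟨⟨m', by linarith⟩, ⟨n', by linarith⟩⟩
  · rintro ⟨⟨m', rfl⟩, ⟨n', rfl⟩⟩
    exact ⟨m' + n' * ω, by push_cast; ring⟩

theorem intCast_dvd_iff (hp : p.Prime) (hpc : p = 4 * c + 1) (hω : ω ^ 2 = ω + c) {r m : ℤ} :
    (r : 𝓞 K) ∣ m ↔ r ∣ m := by
  simpa using dvd_coords_iff hp hpc hω (r := r) (m := m) (n := 0)

/-! ### Ideals whose square is generated by a rational integer -/

/-- A rational prime different from `p` is unramified: the ring of integers modulo it is reduced. -/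
theorem prime_dvd_of_dvd_sq (hp : p.Prime) (hpc : p = 4 * c + 1) (hω : ω ^ 2 = ω + c)
    {r : ℤ} (hr : Prime r) (hrp : ¬ r ∣ p) {α : 𝓞 K} (h : (r : 𝓞 K) ∣ α ^ 2) :
    (r : 𝓞 K) ∣ α := by
  obtain ⟨m, n, rfl⟩ := exists_coords hp hpc hω α
  have h1 : ((m : 𝓞 K) + n * ω) ^ 2 =
      ((m ^ 2 + c * n ^ 2 : ℤ) : 𝓞 K) + ((n * (2 * m + n) : ℤ) : 𝓞 K) * ω := by
    push_cast; linear_combination n ^ 2 * hω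
  rw [h1, dvd_coords_iff hp hpc hω] at h
  obtain ⟨h2, h3⟩ := h
  rw [dvd_coords_iff hp hpc hω]
  have hn : r ∣ n := by
    rcases hr.dvd_or_dvd h3 with h | h
    · exact h
    · have : (p : ℤ) * n ^ 2 =
          4 * (m ^ 2 + c * n ^ 2) + (2 * m + n) * (2 * n - (2 * m + n)) := by
        rw [hpc]; push_cast; ring
      have h4 : r ∣ p * n ^ 2 := this ▸ dvd_add (h2.mul_left _) (h.mul_right _)
      exact hr.dvd_of_dvd_pow ((hr.dvd_or_dvd h4).resolve_left hrp)
  refine ⟨hr.dvd_of_dvd_pow (n := 2) ?_, hn⟩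
  have : m ^ 2 = (m ^ 2 + c * n ^ 2) - n * (c * n) := by ring
  rw [this]
  exact dvd_sub h2 (hn.mul_right _)

/-- An ideal with square `(m)`, `m ∈ ℕ`, is principal, since only `p = (√p)²` ramifies. The generator
found is `a` or `a√p` with `a ∈ ℕ`, so its square is exactly `m`. -/
theorem exists_generator_of_sq_eq_span_nat (hp : p.Prime) (hpc : p = 4 * c + 1)
    (hω : ω ^ 2 = ω + c) (m : ℕ) (hm : m ≠ 0) (J : Ideal (𝓞 K))
    (hJ : J ^ 2 = Ideal.span {(m : 𝓞 K)}) :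
    ∃ k : 𝓞 K, J = Ideal.span {k} ∧ k ^ 2 = m := by
  induction m using Nat.strong_induction_on generalizing J with
  | _ m ih =>
  by_cases hm1 : m = 1
  · subst hm1
    refine ⟨1, ?_, by simp⟩
    simp only [Nat.cast_one, Ideal.span_singleton_one] at hJ ⊢
    exact Ideal.isUnit_iff.mp ((isUnit_pow_iff two_ne_zero).mp (Ideal.isUnit_iff.mpr hJ))
  -- it suffices to split off a nontrivial principal ideal whose square is generated by an integer
  suffices H : ∃ (g : 𝓞 K) (G : ℕ), 1 < G ∧ g ^ 2 = G ∧ Ideal.span {g} ∣ J by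
    obtain ⟨g, G, hG1, hgG, J1, rfl⟩ := H
    have hG0 : (G : 𝓞 K) ≠ 0 := by exact_mod_cast (by omega : G ≠ 0)
    rw [mul_pow, Ideal.span_singleton_pow, hgG] at hJ
    have hdvd : (G : ℤ) ∣ m := by
      rw [← intCast_dvd_iff hp hpc hω (K := K)]
      have : Ideal.span {(G : 𝓞 K)} ∣ Ideal.span {(m : 𝓞 K)} := ⟨_, hJ.symm⟩
      rw [Ideal.dvd_span_singleton, Ideal.mem_span_singleton] at this
      simpa using this
    obtain ⟨m', rfl⟩ : G ∣ m := by exact_mod_cast hdvd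
    have hm' : m' ≠ 0 := by rintro rfl; simp at hm
    push_cast at hJ
    rw [← Ideal.span_singleton_mul_span_singleton, Ideal.span_singleton_mul_right_inj hG0] at hJ
    obtain ⟨k, rfl, hk⟩ := ih m' (by nlinarith [Nat.pos_of_ne_zero hm']) hm' J1 hJ
    refine ⟨g * k, Ideal.span_singleton_mul_span_singleton _ _, ?_⟩
    push_cast
    rw [mul_pow, hgG, hk]
  obtain ⟨r, hr, hrm⟩ := Nat.exists_prime_and_dvd hm1
  have hrJ : Ideal.span {(r : 𝓞 K)} ∣ J ^ 2 := by
    rw [hJ, Ideal.dvd_span_singleton, Ideal.mem_span_singleton]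
    exact_mod_cast Nat.cast_dvd_cast hrm
  by_cases hrp : r = p
  · subst hrp
    have hs : (2 * ω - 1) ^ 2 = (r : 𝓞 K) := two_mul_sub_one_sq hpc hω
    refine ⟨2 * ω - 1, r, hr.one_lt, hs, ?_⟩
    rw [← hs, ← Ideal.span_singleton_pow] at hrJ
    exact (UniqueFactorizationMonoid.pow_dvd_pow_iff_dvd two_ne_zero).mp hrJ
  · refine ⟨r, r ^ 2, by nlinarith [hr.one_lt], by push_cast; ring, ?_⟩
    rw [Ideal.dvd_iff_le]
    intro x hx
    have h2 : x ^ 2 ∈ Ideal.span {(r : 𝓞 K)} :=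
      Ideal.dvd_iff_le.mp hrJ (Ideal.pow_mem_pow hx 2)
    rw [Ideal.mem_span_singleton] at h2 ⊢
    have := prime_dvd_of_dvd_sq hp hpc hω (Nat.prime_iff_prime_int.mp hr)
      (fun h => hrp ((Nat.prime_dvd_prime_iff_eq hr hp).mp (by exact_mod_cast h))) (α := x)
      (by simpa using h2)
    simpa using this

theorem exists_generator_of_sq_eq_span_int (hp : p.Prime) (hpc : p = 4 * c + 1)
    (hω : ω ^ 2 = ω + c) (m : ℤ) (hm : m ≠ 0) (J : Ideal (𝓞 K))
    (hJ : J ^ 2 = Ideal.span {(m : 𝓞 K)}) :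
    ∃ k : 𝓞 K, J = Ideal.span {k} ∧ (k ^ 2 = m ∨ k ^ 2 = -m) := by
  have hspan : Ideal.span {(m : 𝓞 K)} = Ideal.span {((m.natAbs : ℕ) : 𝓞 K)} := by
    rcases Int.natAbs_eq m with h | h
    · conv_lhs => rw [h]
      simp
    · conv_lhs => rw [h]
      simp [Ideal.span_singleton_neg]
  obtain ⟨k, hk, hk2⟩ := exists_generator_of_sq_eq_span_nat hp hpc hω m.natAbs (by simpa using hm) J
    (hJ.trans hspan)
  refine ⟨k, hk, ?_⟩
  have h3 : ((m.natAbs : ℤ) : 𝓞 K) = (m.natAbs : ℕ) := by simp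
  rw [hk2, ← h3]
  rcases Int.natAbs_eq m with h | h
  · left; rw [← h]
  · right; nth_rewrite 2 [h]; simp

/-! ### The norm of the fundamental unit and the parity of the class number -/

/-- If `N ε = 1`, then `(1 + ε)² = m ε` with `m ∈ ℤ`. The ideal `(1 + ε)` has a generator `k` with
`k² = ±m`, so `ε` is `±` a square of a unit, which a fundamental unit is not. -/
theorem norm_eq_neg_one_of_isFundamentalUnit (hp : p.Prime) (hpc : p = 4 * c + 1) (hω : ω ^ 2 = ω + c)
    (φ : K →+* ℝ) {ε : (𝓞 K)ˣ} (hε : IsFundamentalUnit ε) :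
    Algebra.norm ℤ (ε : 𝓞 K) = -1 := by
  refine (Int.isUnit_iff.mp (ε.isUnit.map (Algebra.norm ℤ))).resolve_left fun hN => ?_
  obtain ⟨v, hv⟩ := exists_unit_pow_ne_one hp hpc hω φ
  have hfin : ∀ n : ℤ, n ≠ 0 → ε ^ n ≠ 1 := by
    intro n hn h
    have h1 : ε ^ n.natAbs = 1 := by
      rcases Int.natAbs_eq n with h' | h'
      · rw [← zpow_natCast, ← h', h]
      · rw [← inv_inj, inv_one, ← zpow_natCast, ← zpow_neg, ← h', h]
    refine hv (2 * n.natAbs) (by omega) ?_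
    obtain ⟨k, hk | hk⟩ := hε v
    · rw [hk, mul_comm, pow_mul, ← zpow_natCast (ε ^ k), ← zpow_mul, mul_comm k, zpow_mul,
        zpow_natCast, h1, one_zpow, one_pow]
    · rw [hk, pow_mul, neg_sq, ← pow_mul, mul_comm, pow_mul, ← zpow_natCast (ε ^ k), ← zpow_mul,
        mul_comm k, zpow_mul, zpow_natCast, h1, one_zpow, one_pow]
  have hfin' : ∀ n : ℤ, n ≠ 0 → ε ^ n ≠ -1 := by
    intro n hn h
    refine hfin (n * 2) (by omega) ?_
    rw [zpow_mul, h]; simp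
  have hsq : ∀ u : (𝓞 K)ˣ, ε ≠ u ^ 2 ∧ ε ≠ -u ^ 2 := by
    intro u
    have h2 : ∃ k : ℤ, u ^ 2 = ε ^ (2 * k) := by
      obtain ⟨k, hk | hk⟩ := hε u
      · exact ⟨k, by rw [hk, mul_comm, zpow_mul]; rfl⟩
      · exact ⟨k, by rw [hk, neg_sq, mul_comm, zpow_mul]; rfl⟩
    obtain ⟨k, hk⟩ := h2
    rw [hk]
    constructor
    · intro h
      apply hfin (2 * k - 1) (by omega)
      rw [zpow_sub_one, ← h, mul_inv_cancel]
    · intro h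
      apply hfin' (2 * k - 1) (by omega)
      have : ε ^ (2 * k) = -ε := by rw [h, neg_neg, ← h]
      rw [zpow_sub_one, this, neg_mul, mul_inv_cancel]
  obtain ⟨t, -, -, -, ht⟩ := exists_half_coords hp hpc hω (ε : 𝓞 K)
  rw [hN] at ht
  -- Hilbert 90 made explicit: `ε = β / σ β` with `β = 1 + ε`, and `β * σ β = t + 2`
  have hβ : (1 + ε : 𝓞 K) ^ 2 = ((t + 2 : ℤ) : 𝓞 K) * ε := by
    push_cast at ht ⊢; linear_combination ht
  by_cases ht2 : t + 2 = 0
  · rw [ht2] at hβ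
    simp at hβ
    apply hfin' 1 one_ne_zero
    rw [zpow_one]
    apply Units.ext
    push_cast
    linear_combination hβ
  · have hspan : Ideal.span {(1 + ε : 𝓞 K)} ^ 2 = Ideal.span {((t + 2 : ℤ) : 𝓞 K)} := by
      rw [Ideal.span_singleton_pow, hβ]
      exact Ideal.span_singleton_mul_right_unit ε.isUnit _
    obtain ⟨k, hk, hk2⟩ := exists_generator_of_sq_eq_span_int hp hpc hω _ ht2 _ hspan
    obtain ⟨u, hu⟩ := Ideal.span_singleton_eq_span_singleton.mp hk
    have ht0 : ((t + 2 : ℤ) : 𝓞 K) ≠ 0 := by exact_mod_cast ht2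
    have hku : k ^ 2 = ((t + 2 : ℤ) : 𝓞 K) * (ε * u ^ 2 : 𝓞 K) := by
      rw [← hu, mul_pow, hβ]; ring
    rcases hk2 with h | h
    · rw [h] at hku
      have : (ε * u ^ 2 : 𝓞 K) = 1 := by
        apply mul_left_cancel₀ ht0; rw [← hku, mul_one]
      apply (hsq u⁻¹).1
      rw [inv_pow, ← mul_eq_one_iff_eq_inv]
      exact Units.ext (by simpa using this)
    · rw [h] at hku
      have : (ε * u ^ 2 : 𝓞 K) = -1 := by
        apply mul_left_cancel₀ ht0; rw [← hku, mul_neg_one]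
      apply (hsq u⁻¹).2
      rw [inv_pow, ← neg_eq_iff_eq_neg, ← mul_eq_one_iff_eq_inv, neg_mul, neg_eq_iff_eq_neg]
      exact Units.ext (by simpa using this)

/-- Let `I² = (α)` for a class of order `2`. With a unit of norm `-1` one may take `N α = n²`, where
`n = N I`. Then `(α + n)² = m α` with `m ∈ ℤ`, so the ideal `(α + n) I⁻¹` has square `(m)` and is
principal, and therefore `I` is principal. -/
theorem odd_classNumber (hp : p.Prime) (hpc : p = 4 * c + 1) (hω : ω ^ 2 = ω + c)
    {ε : (𝓞 K)ˣ} (hε : Algebra.norm ℤ (ε : 𝓞 K) = -1) : Odd (classNumber K) := by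
  rw [← Nat.not_even_iff_odd, even_iff_two_dvd]
  intro h2
  obtain ⟨C, hC⟩ := exists_prime_orderOf_dvd_card (G := ClassGroup (𝓞 K)) 2 h2
  obtain ⟨⟨I, hI⟩, rfl⟩ := ClassGroup.mk0_surjective C
  have hI0 : I ≠ ⊥ := nonZeroDivisors.ne_zero hI
  have hsq : (ClassGroup.mk0 ⟨I, hI⟩) ^ 2 = 1 := by rw [← hC]; exact pow_orderOf_eq_one _
  have hne : (ClassGroup.mk0 ⟨I, hI⟩) ≠ 1 := by
    intro h; rw [h, orderOf_one] at hC; omega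
  rw [Ne, ClassGroup.mk0_eq_one_iff] at hne
  apply hne
  rw [← map_pow] at hsq
  have hpr : (I ^ 2).IsPrincipal := (ClassGroup.mk0_eq_one_iff (pow_mem hI 2)).mp hsq
  obtain ⟨α₀, hα₀⟩ := hpr
  set n := Ideal.absNorm I with hn
  have hn0 : (n : ℤ) ≠ 0 := by
    rw [hn]; exact_mod_cast Ideal.absNorm_eq_zero_iff.not.mpr hI0
  obtain ⟨α, hα, hNα⟩ : ∃ α : 𝓞 K, I ^ 2 = Ideal.span {α} ∧ Algebra.norm ℤ α = n ^ 2 := by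
    have h3 : (Algebra.norm ℤ α₀).natAbs = n ^ 2 := by
      rw [← Ideal.absNorm_span_singleton, ← Ideal.submodule_span_eq, ← hα₀, map_pow]
    rcases Int.natAbs_eq (Algebra.norm ℤ α₀) with h | h
    · exact ⟨α₀, hα₀, by rw [h, h3]; push_cast; rfl⟩
    · refine ⟨α₀ * ε, ?_, ?_⟩
      · rw [hα₀, Ideal.submodule_span_eq, Ideal.span_singleton_mul_right_unit ε.isUnit]
      · rw [map_mul, hε, h, h3]; push_cast; ring
  obtain ⟨t, -, -, -, ht⟩ := exists_half_coords hp hpc hω α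
  rw [hNα] at ht
  have hβ : (α + n) ^ 2 = ((t + 2 * n : ℤ) : 𝓞 K) * α := by
    push_cast at ht ⊢; linear_combination ht
  by_cases ht2 : t + 2 * (n : ℤ) = 0
  · have hαn : α = -(n : 𝓞 K) := by
      rw [ht2] at hβ
      simp at hβ
      exact eq_neg_of_add_eq_zero_left hβ
    obtain ⟨k, hk, -⟩ := exists_generator_of_sq_eq_span_int hp hpc hω (n : ℤ) hn0 I
      (by rw [hα, hαn, Ideal.span_singleton_neg]; simp)
    exact ⟨k, hk⟩
  · have ht0 : ((t + 2 * n : ℤ) : 𝓞 K) ≠ 0 := by exact_mod_cast ht2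
    have hsp : Ideal.span {α + (n : 𝓞 K)} ^ 2 = Ideal.span {((t + 2 * n : ℤ) : 𝓞 K)} * I ^ 2 := by
      rw [hα, Ideal.span_singleton_pow, hβ, Ideal.span_singleton_mul_span_singleton]
    have hdvd : I ∣ Ideal.span {α + (n : 𝓞 K)} :=
      (UniqueFactorizationMonoid.pow_dvd_pow_iff_dvd two_ne_zero).mp ⟨_, hsp.trans (mul_comm _ _)⟩
    obtain ⟨J, hJ⟩ := hdvd
    have hJ2 : J ^ 2 = Ideal.span {((t + 2 * n : ℤ) : 𝓞 K)} := by
      rw [hJ, mul_pow, mul_comm] at hsp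
      exact mul_right_cancel₀ (pow_ne_zero 2 hI0) hsp
    obtain ⟨k, rfl, hk⟩ := exists_generator_of_sq_eq_span_int hp hpc hω _ ht2 J hJ2
    have hk0 : k ≠ 0 := by
      rintro rfl
      rcases hk with h | h
      · exact ht0 (by linear_combination -h)
      · exact ht0 (by linear_combination h)
    have hmem : α + n ∈ Ideal.span {k} := by
      rw [← Ideal.dvd_span_singleton, hJ]; exact dvd_mul_left _ _
    obtain ⟨γ, hγ⟩ := Ideal.mem_span_singleton.mp hmem
    refine ⟨γ, ?_⟩
    rw [hγ, ← Ideal.span_singleton_mul_span_singleton, mul_comm I] at hJ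
    exact ((Ideal.span_singleton_mul_right_inj hk0).mp hJ).symm

/-! ### Residue maps and the quadratic residue symbol -/

/-- The residue field of a prime of degree one. Degree one is expressed by the existence of a root `w`
modulo `q` of the minimal polynomial `X² - X - c` of `ω`. -/
theorem exists_residue_map {q : ℕ} [hq : Fact q.Prime] (hp : p.Prime) (hpc : p = 4 * c + 1)
    (hω : ω ^ 2 = ω + c) {w : ℤ} (hw : (q : ℤ) ∣ w ^ 2 - w - c) {𝔮 : Ideal (𝓞 K)}
    (h𝔮 : IsPrimeAbove 𝔮 q) : ∃ f : 𝓞 K →+* ZMod q, RingHom.ker f = 𝔮 := by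
  obtain ⟨hprime, hq𝔮⟩ := h𝔮
  have hw' : ∃ v : ℤ, ω - v ∈ 𝔮 := by
    have h1 : (ω - w) * (ω - ((1 - w : ℤ) : 𝓞 K)) ∈ 𝔮 := by
      obtain ⟨k, hk⟩ := hw
      have hk' : (w : 𝓞 K) ^ 2 - w - c = q * k := by exact_mod_cast congrArg (Int.cast (R := 𝓞 K)) hk
      have : (ω - w) * (ω - ((1 - w : ℤ) : 𝓞 K)) = q * (-k) := by
        push_cast; linear_combination hω - hk'
      rw [this]
      exact 𝔮.mul_mem_right _ hq𝔮
    rcases hprime.mem_or_mem h1 with h | h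
    exacts [⟨_, h⟩, ⟨_, h⟩]
  obtain ⟨v, hv⟩ := hw'
  have : CharP (𝓞 K ⧸ 𝔮) q := by
    have h0 : ((q : ℕ) : 𝓞 K ⧸ 𝔮) = 0 := by
      rw [← map_natCast (Ideal.Quotient.mk 𝔮)]
      exact Ideal.Quotient.eq_zero_iff_mem.mpr hq𝔮
    exact ringChar.of_eq (CharP.ringChar_of_prime_eq_zero hq.out h0)
  have hbij : Function.Bijective (ZMod.castHom (dvd_refl q) (𝓞 K ⧸ 𝔮)) := by
    refine ⟨RingHom.injective _, fun x => ?_⟩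
    obtain ⟨α, rfl⟩ := Ideal.Quotient.mk_surjective x
    obtain ⟨m, n, rfl⟩ := exists_coords hp hpc hω α
    refine ⟨((m + n * v : ℤ) : ZMod q), ?_⟩
    rw [map_intCast, ← map_intCast (Ideal.Quotient.mk 𝔮), Ideal.Quotient.eq]
    have : ((m + n * v : ℤ) : 𝓞 K) - (m + n * ω) = -n * (ω - v) := by push_cast; ring
    rw [this]
    exact 𝔮.mul_mem_left _ hv
  refine ⟨(RingEquiv.ofBijective _ hbij).symm.toRingHom.comp (Ideal.Quotient.mk 𝔮), ?_⟩
  ext x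
  simp [RingHom.mem_ker, Ideal.Quotient.eq_zero_iff_mem]

end QuadraticField

theorem quadSymbol_eq_quadraticChar {R : Type*} [CommRing R] {q : ℕ} [hq : Fact q.Prime]
    (hq2 : q ≠ 2) {𝔮 : Ideal R} (f : R →+* ZMod q) (hf : RingHom.ker f = 𝔮) (α : R) :
    quadSymbol α 𝔮 = quadraticChar (ZMod q) (f α) := by
  have hcard : Nat.card (R ⧸ 𝔮) = q := by
    rw [← hf, Nat.card_congr (RingHom.quotientKerEquivOfSurjective
      (ZMod.ringHom_surjective f)).toEquiv, Nat.card_zmod]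
  have hodd : q % 2 = 1 := hq.out.eq_two_or_odd.resolve_left hq2
  have hmem : ∀ x, x ∈ 𝔮 ↔ f x = 0 := fun x => by rw [← hf, RingHom.mem_ker]
  unfold quadSymbol
  rw [hcard, hmem, hmem, show (q - 1) / 2 = q / 2 by omega, map_sub, map_pow, map_one,
    sub_eq_zero]
  split_ifs with h1 h2
  · rw [h1]; simp
  · exact ((quadraticChar_one_iff_isSquare h1).mpr ((ZMod.euler_criterion q h1).mpr h2)).symm
  · symm
    rw [quadraticChar_neg_one_iff_not_isSquare, ZMod.euler_criterion q h1]
    exact h2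

theorem exists_residue_map_zsqrtd {q : ℕ} [hq : Fact q.Prime] {ρ : ℤ√2} (hρ : ρ.norm = q) :
    ∃ (f : ℤ√2 →+* ZMod q) (t : ZMod q), t ^ 2 = 2 ∧ (∀ z, f z = z.re + z.im * t) ∧
      RingHom.ker f = Ideal.span {ρ} := by
  have hn : ρ.re ^ 2 - 2 * ρ.im ^ 2 = q := by rw [← hρ, Zsqrtd.norm_def]; ring
  have hd : (ρ.im : ZMod q) ≠ 0 := by
    rw [Ne, ZMod.intCast_zmod_eq_zero_iff_dvd]
    exact not_dvd_snd_of_norm_prime hq.out hn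
  have hn' : (ρ.re : ZMod q) ^ 2 - 2 * (ρ.im : ZMod q) ^ 2 = 0 := by
    have := congrArg (Int.cast (R := ZMod q)) hn
    push_cast at this
    rw [this]; simp
  -- modulo `ρ` one has `√2 ≡ -re ρ / im ρ`
  obtain ⟨t, ht⟩ : ∃ t : ZMod q, t = -ρ.re / ρ.im := ⟨_, rfl⟩
  have htd : t * ρ.im = -ρ.re := by rw [ht]; field_simp
  have ht2 : t ^ 2 = 2 := by
    apply mul_right_cancel₀ (pow_ne_zero 2 hd)
    linear_combination (t * ρ.im - ρ.re) * htd + hn'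
  have hf : ∀ z : ℤ√2, Zsqrtd.lift ⟨t, by rw [← sq, ht2]; norm_num⟩ z = z.re + z.im * t :=
    fun z => rfl
  refine ⟨_, t, ht2, hf, ?_⟩
  ext z
  rw [RingHom.mem_ker, hf, Ideal.mem_span_singleton]
  constructor
  · intro h
    have h1 : (q : ℤ) ∣ z.im * ρ.re - z.re * ρ.im := by
      rw [← ZMod.intCast_zmod_eq_zero_iff_dvd]; push_cast
      linear_combination z.im * htd - ρ.im * h
    have h2 : (q : ℤ) ∣ z.re * ρ.re - 2 * z.im * ρ.im := by
      rw [← ZMod.intCast_zmod_eq_zero_iff_dvd]; push_cast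
      linear_combination ρ.re * h - z.im * t * htd + z.im * ρ.im * ht2
    obtain ⟨m, hm⟩ := h1
    obtain ⟨l, hl⟩ := h2
    refine ⟨⟨l, m⟩, ?_⟩
    have hq0 : (q : ℤ) ≠ 0 := by exact_mod_cast hq.out.ne_zero
    ext
    · simp only [Zsqrtd.re_mul]
      apply mul_left_cancel₀ hq0
      linear_combination -z.re * hn + ρ.re * hl + 2 * ρ.im * hm
    · simp only [Zsqrtd.im_mul]
      apply mul_left_cancel₀ hq0
      linear_combination -z.im * hn + ρ.re * hm + ρ.im * hl
  · rintro ⟨w, rfl⟩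
    simp only [Zsqrtd.re_mul, Zsqrtd.im_mul]
    push_cast
    linear_combination (w.re + w.im * t) * htd - ρ.im * w.im * ht2

section QuadraticField

variable {K : Type*} [Field K] [NumberField K]
variable {p c : ℕ} {ω : 𝓞 K}

variable [Algebra.IsQuadraticExtension ℚ K]

/-! ### The symbol of a totally positive generator of `𝔩 ^ h` -/

/-- `2λ = x + y√p` with `x² - p y²` twice a square: `N λ = 2 ^ h` by total positivity, and the class
number `h` is odd. -/
theorem exists_lambda_coords [hp : Fact p.Prime] (hpc : p = 4 * c + 1) (hc : Even c)
    (hω : ω ^ 2 = ω + c) (hodd : Odd (classNumber K)) (φ : K →+* ℝ) {lam : 𝓞 K}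
    (hlam : IsLambda lam) :
    ∃ (x y : ℤ) (k : ℕ), 2 * lam = x + y * (2 * ω - 1) ∧
      x ^ 2 - 2 * (2 ^ k) ^ 2 = p * y ^ 2 := by
  obtain ⟨hpos, 𝔩, h𝔩, hgen⟩ := hlam
  have : Fact (Nat.Prime 2) := ⟨Nat.prime_two⟩
  obtain ⟨f, hf⟩ := exists_residue_map (q := 2) hp.out hpc hω (w := 0)
    (by obtain ⟨m, hm⟩ := hc; exact ⟨-m, by rw [hm]; push_cast; ring⟩) h𝔩
  have habs : Ideal.absNorm 𝔩 = 2 := by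
    rw [Ideal.absNorm_apply, Submodule.cardQuot_apply, ← hf]
    exact (Nat.card_congr (RingHom.quotientKerEquivOfSurjective
      (ZMod.ringHom_surjective f)).toEquiv).trans (Nat.card_zmod 2)
  have hnat : (Algebra.norm ℤ lam).natAbs = 2 ^ classNumber K := by
    rw [← Ideal.absNorm_span_singleton, ← hgen, map_pow, habs]
  have hN0 : 0 < Algebra.norm ℤ lam := by
    obtain ⟨σ, -, hN, -⟩ := exists_conj hp.out hpc hω
    have h1 : ((Algebra.norm ℤ lam : ℤ) : K) = lam * σ lam := by
      rw [← hN, ← Algebra.coe_norm_int]; simp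
    have h2 : ((Algebra.norm ℤ lam : ℤ) : ℝ) = φ lam * (φ.comp (σ : K →+* K)) lam := by
      have := congrArg φ h1
      rw [map_mul, map_intCast] at this
      exact this
    have h3 := mul_pos (hpos φ) (hpos (φ.comp (σ : K →+* K)))
    rw [← h2] at h3
    exact_mod_cast h3
  have hN : Algebra.norm ℤ lam = 2 ^ classNumber K := by
    have : ((Algebra.norm ℤ lam).natAbs : ℤ) = Algebra.norm ℤ lam := Int.natAbs_of_nonneg hN0.le
    rw [← this, hnat]; push_cast; rfl
  obtain ⟨x, y, h1, h2, -⟩ := exists_half_coords hp.out hpc hω lam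
  obtain ⟨j, hj⟩ := hodd
  refine ⟨x, y, j + 1, h1, ?_⟩
  rw [hN, hj] at h2
  have : (4 : ℤ) * 2 ^ (2 * j + 1) = 2 * (2 ^ (j + 1)) ^ 2 := by ring
  rw [this] at h2
  linarith

/-- `(λ_p/q) = [ρ/π]` for any `ρ` of norm `q` and any `π` of norm `p`, the latter entering only
through the value `τ` of `√2` modulo `π`. -/
theorem quadSymbol_lambda_eq {q : ℕ} [hp : Fact p.Prime] [hq : Fact q.Prime]
    (hp8 : p % 8 = 1) (hq8 : q % 8 = 1) (hne : p ≠ q) (hpq : IsSquare (p : ZMod q))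
    (hqp : IsSquare (q : ZMod p)) (hK : IsSquare (p : K)) {𝔮 : Ideal (𝓞 K)}
    (h𝔮 : IsPrimeAbove 𝔮 q) {ε : (𝓞 K)ˣ} (hε : IsFundamentalUnit ε) {lam : 𝓞 K}
    (hlam : IsLambda lam) {a b : ℤ} (hab : a ^ 2 - 2 * b ^ 2 = q) {τ : ZMod p} (hτ : τ ^ 2 = 2) :
    quadSymbol lam 𝔮 = quadraticChar (ZMod p) (a + b * τ) := by
  have hq2 : q ≠ 2 := by rintro rfl; omega
  have hp2 : p ≠ 2 := by rintro rfl; omega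
  obtain ⟨c, hpc⟩ : ∃ c, p = 4 * c + 1 := ⟨p / 4, by omega⟩
  have hc : Even c := ⟨p / 8, by omega⟩
  obtain ⟨ω, hω⟩ := exists_half_one_add_sqrt hpc hK
  obtain ⟨φ⟩ := exists_real_embedding hp.out hpc hω
  have hodd := odd_classNumber hp.out hpc hω
    (norm_eq_neg_one_of_isFundamentalUnit hp.out hpc hω φ hε)
  obtain ⟨x, y, k, hxy, hk⟩ := exists_lambda_coords hpc hc hω hodd φ hlam
  have h2 : (2 : ZMod q) ≠ 0 := by
    have := (ZMod.natCast_eq_zero_iff 2 q).not.mpr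
      (fun h => hq2 ((Nat.prime_dvd_prime_iff_eq hq.out Nat.prime_two).mp h))
    exact_mod_cast this
  obtain ⟨w, hw⟩ : ∃ w : ℤ, (q : ℤ) ∣ w ^ 2 - w - c := by
    obtain ⟨r, hr⟩ := hpq
    obtain ⟨w, hw⟩ := ZMod.intCast_surjective ((1 + r) / 2)
    refine ⟨w, ?_⟩
    rw [← ZMod.intCast_zmod_eq_zero_iff_dvd]
    push_cast
    rw [hw]
    have : (p : ZMod q) = 4 * c + 1 := by rw [hpc]; push_cast; ring
    rw [this] at hr
    field_simp
    linear_combination -hr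
  obtain ⟨f, hf⟩ := exists_residue_map hp.out hpc hω hw h𝔮
  rw [quadSymbol_eq_quadraticChar hq2 f hf]
  have hs : f (2 * ω - 1) ^ 2 = (p : ZMod q) := by
    rw [← map_pow, ← map_natCast f, two_mul_sub_one_sq hpc hω]
  have hfl : 2 * f lam = x + y * f (2 * ω - 1) := by
    have := congrArg f hxy
    rwa [map_mul, map_add, map_mul, map_intCast, map_intCast, map_ofNat] at this
  have hk' : (x : ZMod q) ^ 2 - 2 * (2 ^ k) ^ 2 = p * y ^ 2 := by
    exact_mod_cast congrArg (Int.cast (R := ZMod q)) hk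
  generalize f (2 * ω - 1) = s at hs hfl
  obtain ⟨t₀, ht₀⟩ := (ZMod.exists_sq_eq_two_iff hq2).mpr (Or.inl hq8)
  have hx0 : ((2 : ZMod q) ^ k) ≠ 0 := pow_ne_zero _ h2
  -- one square root of `2` may be a zero of `x + z t`, but not both
  obtain ⟨t, ht, hxt⟩ : ∃ t : ZMod q, t ^ 2 = 2 ∧ (x : ZMod q) + ((2 ^ k : ℤ) : ZMod q) * t ≠ 0 := by
    by_contra! H
    have h3 := H t₀ (by rw [ht₀, sq])
    have h4 := H (-t₀) (by rw [neg_sq, ht₀, sq])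
    push_cast at h3 h4
    have ht0 : t₀ ≠ 0 := by rintro rfl; simp at ht₀; exact h2 ht₀
    exact mul_ne_zero (mul_ne_zero h2 hx0) ht0 (by linear_combination h3 - h4)
  have hlam0 : f lam ≠ 0 := by
    intro h0
    rw [h0, mul_zero] at hfl
    exact mul_ne_zero h2 (pow_ne_zero 2 hx0)
      (by linear_combination -hk' - (x - y * s) * hfl + y ^ 2 * hs)
  -- `2 (x + y√p) (x + z√2) = (x + y√p + z√2) ^ 2` whenever `x ^ 2 - p y ^ 2 = 2 z ^ 2`
  have hsq : f lam * (x + ((2 ^ k : ℤ) : ZMod q) * t) = ((x + y * s + 2 ^ k * t) / 2) ^ 2 := by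
    push_cast
    field_simp
    linear_combination 2 * (x + 2 ^ k * t) * hfl + hk' - y ^ 2 * hs - (2 ^ k) ^ 2 * ht
  have hχ : quadraticChar (ZMod q) (f lam) *
      quadraticChar (ZMod q) (x + ((2 ^ k : ℤ) : ZMod q) * t) = 1 := by
    rw [← map_mul, quadraticChar_one_iff_isSquare (mul_ne_zero hlam0 hxt), hsq]
    exact ⟨_, sq _⟩
  have hcross := quadraticChar_add_mul_sqrtTwo hp8 hq8 hne hqp (X := x) (Z := 2 ^ k) (Y := y) hk hab
    (fun h => hp2 ((Nat.prime_dvd_prime_iff_eq hp.out Nat.prime_two).mp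
      (by exact_mod_cast (Nat.prime_iff_prime_int.mp hp.out).dvd_of_dvd_pow h)))
    (fun r hr hro _ h => by
      have : r = 2 := (Nat.prime_dvd_prime_iff_eq hr Nat.prime_two).mp
        (by exact_mod_cast (Nat.prime_iff_prime_int.mp hr).dvd_of_dvd_pow h)
      subst this
      exact absurd hro (by decide)) ht hxt hτ
  have hχ2 : quadraticChar (ZMod p) ((2 ^ k : ℤ) : ZMod p) = 1 := by
    push_cast
    have h2p : (2 : ZMod p) ≠ 0 := by
      have := (ZMod.natCast_eq_zero_iff 2 p).not.mpr
        (fun h => hp2 ((Nat.prime_dvd_prime_iff_eq hp.out Nat.prime_two).mp h))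
      exact_mod_cast this
    rw [map_pow, (quadraticChar_one_iff_isSquare h2p).mpr ⟨τ, by rw [← hτ, sq]⟩, one_pow]
  rw [hχ2, one_mul] at hcross
  rw [← hcross]
  rcases Int.eq_one_or_neg_one_of_mul_eq_one' hχ with ⟨h1, h2⟩ | ⟨h1, h2⟩ <;> rw [h1, h2]

end QuadraticField

theorem corollary2 (p q : ℕ) (hp : p.Prime) (hq : q.Prime)
    (hp8 : p % 8 = 1) (hq8 : q % 8 = 1)
    (hpq : IsSquare (p : ZMod q)) (hne : p ≠ q)
    (Kp : Type*) [Field Kp] [NumberField Kp] [Algebra.IsQuadraticExtension ℚ Kp]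
    (hKp : IsSquare (p : Kp))
    (Kq : Type*) [Field Kq] [NumberField Kq] [Algebra.IsQuadraticExtension ℚ Kq]
    (hKq : IsSquare (q : Kq))
    -- a prime of `ℚ(√p)` above `q` and a prime of `ℚ(√q)` above `p`
    (𝔮 : Ideal (𝓞 Kp)) (h𝔮 : IsPrimeAbove 𝔮 q)
    (𝔭 : Ideal (𝓞 Kq)) (h𝔭 : IsPrimeAbove 𝔭 p)
    -- the hypotheses `(ε_p/q) = (ε_q/p) = +1`
    (εp : (𝓞 Kp)ˣ) (hεp : IsFundamentalUnit εp) (hεpq : quadSymbol (εp : 𝓞 Kp) 𝔮 = 1)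
    (εq : (𝓞 Kq)ˣ) (hεq : IsFundamentalUnit εq) (hεqp : quadSymbol (εq : 𝓞 Kq) 𝔭 = 1)
    (lamp : 𝓞 Kp) (hlamp : IsLambda lamp)
    (lamq : 𝓞 Kq) (hlamq : IsLambda lamq) :
    quadSymbol lamp 𝔮 = quadSymbol lamq 𝔭 ∧
    ∀ π₂ ρ₂ : ℤ√2, π₂.norm = p → ρ₂.norm = q →
      quadSymbol lamp 𝔮 = quadSymbol π₂ (Ideal.span {ρ₂}) ∧
      quadSymbol π₂ (Ideal.span {ρ₂}) = quadSymbol ρ₂ (Ideal.span {π₂}) ∧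
      quadSymbol ρ₂ (Ideal.span {π₂}) = quadSymbol lamq 𝔭 := by
  have : Fact p.Prime := ⟨hp⟩
  have : Fact q.Prime := ⟨hq⟩
  have hp2 : p ≠ 2 := by rintro rfl; omega
  have hq2 : q ≠ 2 := by rintro rfl; omega
  have hqp : IsSquare (q : ZMod p) :=
    (ZMod.exists_sq_eq_prime_iff_of_mod_four_eq_one (by omega) hq2).mpr hpq
  have hn : ∀ z : ℤ√2, z.norm = z.re ^ 2 - 2 * z.im ^ 2 := fun z => by rw [Zsqrtd.norm_def]; ring
  have main : ∀ π₂ ρ₂ : ℤ√2, π₂.norm = p → ρ₂.norm = q →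
      quadSymbol lamp 𝔮 = quadSymbol π₂ (Ideal.span {ρ₂}) ∧
      quadSymbol π₂ (Ideal.span {ρ₂}) = quadSymbol ρ₂ (Ideal.span {π₂}) ∧
      quadSymbol ρ₂ (Ideal.span {π₂}) = quadSymbol lamq 𝔭 := by
    intro π₂ ρ₂ hπ hρ
    obtain ⟨f, t, ht, hft, hf⟩ := exists_residue_map_zsqrtd hρ
    obtain ⟨g, τ, hτ, hgτ, hg⟩ := exists_residue_map_zsqrtd hπ
    rw [hn] at hπ hρ
    rw [quadSymbol_eq_quadraticChar hq2 f hf, quadSymbol_eq_quadraticChar hp2 g hg, hft, hgτ,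
      quadSymbol_lambda_eq hp8 hq8 hne hpq hqp hKp h𝔮 hεp hlamp hρ hτ,
      quadSymbol_lambda_eq hq8 hp8 hne.symm hqp hpq hKq h𝔭 hεq hlamq hπ ht,
      quadraticChar_reciprocity hp8 hq8 hne hqp hπ hρ ht hτ]
    exact ⟨rfl, rfl, rfl⟩
  refine ⟨?_, main⟩
  obtain ⟨a, b, hab⟩ := exists_norm_eq_prime hp8
  obtain ⟨c, d, hcd⟩ := exists_norm_eq_prime hq8
  obtain ⟨h1, h2, h3⟩ := main ⟨a, b⟩ ⟨c, d⟩ (by rw [hn, ← hab]) (by rw [hn, ← hcd])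
  exact h1.trans (h2.trans h3)
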